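/- Let $\Bbbk=\mathbb R$ or $\mathbb C$, and let $\mathbb S^n$ be the set of $n\times n$ Hermitian matrices over $\Bbbk$ (real symmetric if $\Bbbk=\mathbb R$). For $A=(a_{ij})\in\mathbb S^n$ and $d\ge n$ put $$\lVert A\rVert_{\gamma}=\max\Bigl\{\Bigl\lvert\sum_{i,j=1}^n a_{ij}\langle x_i,x_j\rangle\Bigr\rvert : x_1,\dots,x_n\in\Bbbk^d,\ \lVert x_i\rVert=1\Bigr\},\qquad \lVert A\rVert_{\theta}=\max\Bigl\{\Bigl\lvert\sum_{i,j=1}^n a_{ij}\bar\delta_i\delta_j\Bigr\rvert : \delta_1,\dots,\delta_n\in\Bbbk,\ \lvert\delta_i\rvert=1\Bigr\},$$ where $\langle x,y\rangle=x^*y$. Let $$\operatorname{str}(A)=\max_{x\in\mathbb T^n}x^*Ax-\min_{x\in\mathbb T^n}x^*Ax,\qquad \operatorname{spr}(A)=\max_{X\in\mathbb G^n}\operatorname{tr}(AX)-\min_{X\in\mathbb G^n}\operatorname{tr}(AX),$$ where $\mathbb T^n=\{x\in\Bbbk^n:\lvert x_1\rvert=\dots=\lvert x_n\rvert=1\}$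 and $\mathbb G^n$ is the set of $n\times n$ correlation matrices, i.e. positive semidefinite matrices over $\Bbbk$ all of whose diagonal entries are $1$. **Theorem.** There is a smallest real constant $K_\gamma=K_\gamma^{\Bbbk}$ such that $\lVert A\rVert_\gamma\le K_\gamma\lVert A\rVert_\theta$ for all $n$, all $d\ge n$ and all $A\in\mathbb S^n$ (the symmetric Grothendieck constant for the $\gamma$-seminorm), and for every $n$ and every $A\in\mathbb S^n$, $$\operatorname{str}(A)\le\operatorname{spr}(A)\le K_\gamma\operatorname{str}(A).$$ -/

import Mathlib

open scoped ComplexOrder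

noncomputable section

namespace SymGrothendieck

variable (𝕜 : Type*) [RCLike 𝕜]

/-- The vectors `x ∈ 𝕜ⁿ` all of whose coordinates have modulus one
(`{-1, 1}ⁿ` when `𝕜 = ℝ`, the `n`-torus when `𝕜 = ℂ`). -/
def unimodular (n : ℕ) : Set (Fin n → 𝕜) :=
  {x | ∀ i, ‖x i‖ = 1}

/-- The `n × n` correlation matrices: positive semidefinite with unit diagonal. -/
def correlation (n : ℕ) : Set (Matrix (Fin n) (Fin n) 𝕜) :=
  {X | X.PosSemidef ∧ ∀ i, X i i = 1}

/-- The `n`-tuples of unit vectors in `𝕜ᵈ`. -/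
def unitTuples (d n : ℕ) : Set (Fin n → EuclideanSpace 𝕜 (Fin d)) :=
  {x | ∀ i, ‖x i‖ = 1}

variable {𝕜}

/-- The set of values of `x* A x` over unimodular `x`
(these values are real when `A` is Hermitian). -/
def quadValues {n : ℕ} (A : Matrix (Fin n) (Fin n) 𝕜) : Set ℝ :=
  (fun x : Fin n → 𝕜 => RCLike.re (star x ⬝ᵥ A.mulVec x)) '' unimodular 𝕜 n

/-- The set of values of `tr (A X)` over correlation matrices `X`
(these values are real when `A` is Hermitian). -/
def traceValues {n : ℕ} (A : Matrix (Fin n) (Fin n) 𝕜) : Set ℝ :=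
  (fun X : Matrix (Fin n) (Fin n) 𝕜 => RCLike.re (A * X).trace) '' correlation 𝕜 n

/-- The stretch of `A`: maximum minus minimum of `x* A x` over unimodular `x`. -/
def stretch {n : ℕ} (A : Matrix (Fin n) (Fin n) 𝕜) : ℝ :=
  sSup (quadValues A) - sInf (quadValues A)

/-- The spread of `A`: maximum minus minimum of `tr (A X)` over correlation matrices `X`. -/
def spread {n : ℕ} (A : Matrix (Fin n) (Fin n) 𝕜) : ℝ :=
  sSup (traceValues A) - sInf (traceValues A)

/-- The set of values of `|∑ i, ∑ j, a i j ⟨x i, x j⟩|` over unit vectors `x i ∈ 𝕜ᵈ`. -/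
def gammaValues (d : ℕ) {n : ℕ} (A : Matrix (Fin n) (Fin n) 𝕜) : Set ℝ :=
  (fun x : Fin n → EuclideanSpace 𝕜 (Fin d) => ‖∑ i, ∑ j, A i j * inner 𝕜 (x i) (x j)‖) ''
    unitTuples 𝕜 d n

/-- The set of values of `|∑ i, ∑ j, a i j conj(δ i) δ j|` over unimodular `δ`. -/
def thetaValues {n : ℕ} (A : Matrix (Fin n) (Fin n) 𝕜) : Set ℝ :=
  (fun δ : Fin n → 𝕜 => ‖∑ i, ∑ j, A i j * star (δ i) * δ j‖) '' unimodular 𝕜 n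

/-- The `(γ, d)`-seminorm. -/
def gammaSeminorm (d : ℕ) {n : ℕ} (A : Matrix (Fin n) (Fin n) 𝕜) : ℝ :=
  sSup (gammaValues d A)

/-- The `θ`-seminorm. -/
def thetaSeminorm {n : ℕ} (A : Matrix (Fin n) (Fin n) 𝕜) : ℝ :=
  sSup (thetaValues A)

variable (𝕜)

/-- The constants for which the symmetric Grothendieck inequality for the `γ`-seminorm holds,
for all sizes `n`, all `d ≥ n` and all Hermitian `A`. -/
def grothendieckConstants : Set ℝ :=
  {K | ∀ n d : ℕ, n ≤ d → ∀ A : Matrix (Fin n) (Fin n) 𝕜, A.IsHermitian →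
    gammaSeminorm d A ≤ K * thetaSeminorm A}

/-- The symmetric Grothendieck constant `K_γ`: the smallest of these constants. -/
def Kγ : ℝ := sInf (grothendieckConstants 𝕜)

/-! The suprema and infima above are maxima and minima. -/

theorem isCompact_unimodular (n : ℕ) : IsCompact (unimodular 𝕜 n) := by
  have h : unimodular 𝕜 n = Set.univ.pi fun _ : Fin n => Metric.sphere (0 : 𝕜) 1 := by
    ext x; simp [unimodular]
  rw [h]
  exact isCompact_univ_pi fun _ => isCompact_sphere _ _

theorem isCompact_unitTuples (d n : ℕ) : IsCompact (unitTuples 𝕜 d n) := by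
  have h : unitTuples 𝕜 d n =
      Set.univ.pi fun _ : Fin n => Metric.sphere (0 : EuclideanSpace 𝕜 (Fin d)) 1 := by
    ext x; simp [unitTuples]
  rw [h]
  exact isCompact_univ_pi fun _ => isCompact_sphere _ _

theorem unimodular_nonempty (n : ℕ) : (unimodular 𝕜 n).Nonempty :=
  ⟨fun _ => 1, fun _ => norm_one⟩

theorem unitTuples_nonempty {d n : ℕ} (h : n ≤ d) : (unitTuples 𝕜 d n).Nonempty :=
  ⟨fun i => EuclideanSpace.single (Fin.castLE h i) 1, fun i => by simp⟩

theorem correlation_nonempty (n : ℕ) : (correlation 𝕜 n).Nonempty :=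
  ⟨1, Matrix.PosSemidef.one, fun i => by simp⟩

/-- Correlation matrices are the Gram matrices of unit vectors. -/
theorem correlation_eq_gram (n : ℕ) :
    correlation 𝕜 n = (fun x => Matrix.gram 𝕜 x) '' unitTuples 𝕜 n n := by
  ext X
  constructor
  · rintro ⟨hX, h1⟩
    obtain ⟨B, rfl⟩ : ∃ B : Matrix (Fin n) (Fin n) 𝕜, X = B.conjTranspose * B := by
      open scoped MatrixOrder Matrix.Norms.L2Operator in
      exact CStarAlgebra.nonneg_iff_eq_star_mul_self.mp hX.nonneg
    have hg : Matrix.gram 𝕜 (fun j => (WithLp.toLp 2 (fun i => B i j) : EuclideanSpace 𝕜 (Fin n)))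
        = B.conjTranspose * B := by
      ext i j
      simp [Matrix.gram_apply, Matrix.mul_apply, PiLp.inner_apply, mul_comm]
    refine ⟨_, fun i => ?_, hg⟩
    have h2 := h1 i
    rw [← hg, Matrix.gram_apply, inner_self_eq_norm_sq_to_K] at h2
    have h3 : ‖(WithLp.toLp 2 (fun k => B k i) : EuclideanSpace 𝕜 (Fin n))‖ ^ 2 = 1 := by
      exact_mod_cast h2
    exact (pow_eq_one_iff_of_nonneg (norm_nonneg _) two_ne_zero).mp h3
  · rintro ⟨x, hx, rfl⟩
    refine ⟨Matrix.posSemidef_gram 𝕜 x, fun i => ?_⟩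
    simp [Matrix.gram_apply, inner_self_eq_norm_sq_to_K, hx i]

theorem isCompact_correlation (n : ℕ) : IsCompact (correlation 𝕜 n) := by
  rw [correlation_eq_gram]
  refine (isCompact_unitTuples 𝕜 n n).image ?_
  refine continuous_matrix fun i j => ?_
  simp only [Matrix.gram_apply]
  fun_prop

variable {𝕜}

theorem isCompact_quadValues {n : ℕ} (A : Matrix (Fin n) (Fin n) 𝕜) :
    IsCompact (quadValues A) := by
  refine (isCompact_unimodular 𝕜 n).image (RCLike.continuous_re.comp ?_)
  exact continuous_star.dotProduct (continuous_const.matrix_mulVec continuous_id)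

theorem isCompact_traceValues {n : ℕ} (A : Matrix (Fin n) (Fin n) 𝕜) :
    IsCompact (traceValues A) := by
  refine (isCompact_correlation 𝕜 n).image (RCLike.continuous_re.comp ?_)
  exact (continuous_const.matrix_mul continuous_id).matrix_trace

theorem isGreatest_quadValues {n : ℕ} (A : Matrix (Fin n) (Fin n) 𝕜) :
    IsGreatest (quadValues A) (sSup (quadValues A)) :=
  (isCompact_quadValues A).isGreatest_sSup ((unimodular_nonempty 𝕜 n).image _)

theorem isLeast_quadValues {n : ℕ} (A : Matrix (Fin n) (Fin n) 𝕜) :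
    IsLeast (quadValues A) (sInf (quadValues A)) :=
  (isCompact_quadValues A).isLeast_sInf ((unimodular_nonempty 𝕜 n).image _)

theorem isGreatest_traceValues {n : ℕ} (A : Matrix (Fin n) (Fin n) 𝕜) :
    IsGreatest (traceValues A) (sSup (traceValues A)) :=
  (isCompact_traceValues A).isGreatest_sSup ((correlation_nonempty 𝕜 n).image _)

theorem isLeast_traceValues {n : ℕ} (A : Matrix (Fin n) (Fin n) 𝕜) :
    IsLeast (traceValues A) (sInf (traceValues A)) :=
  (isCompact_traceValues A).isLeast_sInf ((correlation_nonempty 𝕜 n).image _)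

theorem isGreatest_gammaValues {d n : ℕ} (h : n ≤ d) (A : Matrix (Fin n) (Fin n) 𝕜) :
    IsGreatest (gammaValues d A) (gammaSeminorm d A) := by
  refine IsCompact.isGreatest_sSup ((isCompact_unitTuples 𝕜 d n).image ?_)
    ((unitTuples_nonempty 𝕜 h).image _)
  fun_prop

theorem isGreatest_thetaValues {n : ℕ} (A : Matrix (Fin n) (Fin n) 𝕜) :
    IsGreatest (thetaValues A) (thetaSeminorm A) := by
  refine IsCompact.isGreatest_sSup ((isCompact_unimodular 𝕜 n).image ?_)
    ((unimodular_nonempty 𝕜 n).image _)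
  fun_prop

end SymGrothendieck

end

/-!
Only the finiteness of `K_γ`, that is Grothendieck's inequality, needs work. Subtracting a real
diagonal from `A` makes `x* A x` affine in every coordinate, so that its bound `θ` on the torus
extends to the polydisc. If `C` bounds `∑ k, Q (x k)` over all families with coordinate second
moments at most one, replace a family by the random variable `f = ∑ k, ± x k` and truncate it
coordinatewise at level `√192`: the truncation has values in a polydisc and contributes at most
`192 θ`, while fourth moments show that the error is at most `C / 2`. Hence `192 θ + C / 2` is
again a bound, and the best bound is at most `384 θ`.

Adding a multiple `s` of the identity translates `x* A x` and `tr (A X)` by `s n`. It therefore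
preserves the spread, and for the right `s` it makes `θ` half the stretch.
-/

namespace SymGrothendieck

universe u v w

section Polarization

variable {R M : Type*} [CommRing R] [AddCommGroup M] [Module R M] (Q : QuadraticForm R M)

theorem map_add_add_map_sub (u v : M) : Q (u + v) + Q (u - v) = 2 * (Q u + Q v) := by
  rw [sub_eq_add_neg u v, QuadraticMap.map_add Q, QuadraticMap.map_add Q, QuadraticMap.map_neg,
    QuadraticMap.polar_neg_right]
  ring

theorem map_add_sub_map_sub (u v : M) : Q (u + v) - Q (u - v) = 2 * QuadraticMap.polar Q u v := by
  rw [sub_eq_add_neg u v, QuadraticMap.map_add Q, QuadraticMap.map_add Q, QuadraticMap.map_neg,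
    QuadraticMap.polar_neg_right]
  ring

theorem polar_add_sub (u v : M) : QuadraticMap.polar Q (u + v) (u - v) = 2 * (Q u - Q v) := by
  rw [QuadraticMap.polar_add_left, QuadraticMap.polar_sub_right, QuadraticMap.polar_sub_right,
    QuadraticMap.polar_self, QuadraticMap.polar_self, QuadraticMap.polar_comm Q v u]
  simp only [nsmul_eq_mul]
  push_cast
  ring

end Polarization

section SeparatelyConvex

variable {ι E : Type*} [DecidableEq ι] [NormedAddCommGroup E] [NormedSpace ℝ E]

theorem exists_norm_eq_one_le_of_convexOn_update [Finite ι] [Nontrivial E] {f : (ι → E) → ℝ}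
    (hf : ∀ x i, ConvexOn ℝ Set.univ fun y => f (Function.update x i y))
    {w : ι → E} (hw : ∀ i, ‖w i‖ ≤ 1) : ∃ x : ι → E, (∀ i, ‖x i‖ = 1) ∧ f w ≤ f x := by
  cases nonempty_fintype ι
  suffices hpartial : ∀ s : Finset ι, ∃ x : ι → E,
      (∀ i ∈ s, ‖x i‖ = 1) ∧ (∀ i ∉ s, x i = w i) ∧ f w ≤ f x by
    obtain ⟨x, hx, -, hfx⟩ := hpartial Finset.univ
    exact ⟨x, fun i => hx i (Finset.mem_univ i), hfx⟩
  intro s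
  induction s using Finset.induction_on with
  | empty => exact ⟨w, by simp⟩
  | insert a s ha ih =>
    obtain ⟨x, hxs, hxw, hfx⟩ := ih
    have hxa : x a ∈ convexHull ℝ (Metric.sphere (0 : E) 1) := by
      rw [convexHull_sphere_eq_closedBall _ zero_le_one, hxw a ha]
      simpa using hw a
    obtain ⟨y, hy, hxy⟩ :=
      (hf x a).exists_ge_of_mem_convexHull (Set.subset_univ _) hxa
    refine ⟨Function.update x a y, fun i hi => ?_, fun i hi => ?_, hfx.trans ?_⟩
    · rcases eq_or_ne i a with rfl | hia
      · simpa using hy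
      · simpa [hia] using hxs i (Finset.mem_of_mem_insert_of_ne hi hia)
    · rw [Finset.mem_insert, not_or] at hi
      simpa [hi.1] using hxw i hi.2
    · simpa using hxy

variable {Q : QuadraticForm ℝ (ι → E)}

theorem convexOn_abs_map_update_add (hQ : ∀ i u, Q (Pi.single i u) = 0) (t : ℝ) (x : ι → E)
    (i : ι) : ConvexOn ℝ Set.univ fun y => |Q (Function.update x i y) + t| := by
  let L : E →ₗ[ℝ] ℝ := Q.polarBilin (Function.update x i 0) ∘ₗ LinearMap.single ℝ (fun _ => E) i
  have hL : ∀ y, Q (Function.update x i y) + t = L y + (Q (Function.update x i 0) + t) := by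
    intro y
    have hupdate : Function.update x i y = Function.update x i 0 + Pi.single i y := by
      ext j
      rcases eq_or_ne j i with rfl | hji
      · simp
      · simp [hji]
    rw [hupdate, QuadraticMap.map_add Q, hQ]
    simp only [L, LinearMap.comp_apply, QuadraticMap.polarBilin_apply_apply,
      LinearMap.single_apply]
    ring
  rw [funext fun y => congrArg abs (hL y)]
  exact (convexOn_norm convex_univ).comp_affineMap (L.toAffineMap + AffineMap.const ℝ E _)

variable [Finite ι] [Nontrivial E]

theorem abs_map_add_le_of_norm_le_one (hQ : ∀ i u, Q (Pi.single i u) = 0) {t θ : ℝ}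
    (hθ : ∀ x, (∀ i, ‖x i‖ = 1) → |Q x + t| ≤ θ) {w : ι → E} (hw : ∀ i, ‖w i‖ ≤ 1) :
    |Q w + t| ≤ θ := by
  obtain ⟨x, hx, hwx⟩ := exists_norm_eq_one_le_of_convexOn_update
    (f := fun x => |Q x + t|) (convexOn_abs_map_update_add hQ t) hw
  exact hwx.trans (hθ x hx)

theorem abs_map_le_mul_of_norm_sq_le (hQ : ∀ i u, Q (Pi.single i u) = 0) {θ : ℝ}
    (hθ : ∀ x, (∀ i, ‖x i‖ = 1) → |Q x| ≤ θ) {R : ℝ} (hR : 0 ≤ R) {w : ι → E}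
    (hw : ∀ i, ‖w i‖ ^ 2 ≤ R) : |Q w| ≤ R * θ := by
  rcases hR.eq_or_lt with rfl | hR
  · have hw0 : w = 0 := funext fun i => by simpa using (hw i).antisymm (sq_nonneg _)
    simp [hw0]
  have hscaled : |Q ((√R)⁻¹ • w) + 0| ≤ θ := by
    refine abs_map_add_le_of_norm_le_one hQ (by simpa using hθ) fun i => ?_
    rw [Pi.smul_apply, norm_smul, norm_inv, Real.norm_of_nonneg (Real.sqrt_nonneg R),
      inv_mul_le_one₀ (Real.sqrt_pos.mpr hR)]
    exact Real.le_sqrt_of_sq_le (hw i)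
  rwa [add_zero, QuadraticMap.map_smul, ← mul_inv, Real.mul_self_sqrt hR.le, smul_eq_mul,
    abs_mul, abs_of_pos (inv_pos.mpr hR), inv_mul_le_iff₀ hR] at hscaled

end SeparatelyConvex

section SignedSums

variable {κ V W : Type*} [DecidableEq κ] [AddCommGroup V]

/-- The signed sum `∑ k ∈ s, ± x k` with sign `+` on `t` and `-` on `s \ t`. As `t` runs over
`s.powerset`, these are the values of the Rademacher sum of the family `x`. -/
def signedSum (x : κ → V) (s t : Finset κ) : V :=
  ∑ k ∈ t, x k - ∑ k ∈ s \ t, x k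

theorem signedSum_apply {ι : Type*} (x : κ → ι → V) (s t : Finset κ) (i : ι) :
    signedSum x s t i = signedSum (fun k => x k i) s t := by
  simp [signedSum]

theorem sum_powerset_insert_signedSum [AddCommMonoid W] (F : V → W) (x : κ → V) {a : κ}
    {s : Finset κ} (ha : a ∉ s) :
    ∑ t ∈ (insert a s).powerset, F (signedSum x (insert a s) t) =
      ∑ t ∈ s.powerset, (F (signedSum x s t + x a) + F (signedSum x s t - x a)) := by
  rw [Finset.sum_powerset_insert ha, ← Finset.sum_add_distrib]
  refine Finset.sum_congr rfl fun t ht => ?_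
  have hat : a ∉ t := fun h => ha (Finset.mem_powerset.mp ht h)
  have hminus : signedSum x (insert a s) t = signedSum x s t - x a := by
    rw [signedSum, Finset.insert_sdiff_of_notMem s hat, Finset.sum_insert (by simp [ha]),
      signedSum]
    abel
  have hplus : signedSum x (insert a s) (insert a t) = signedSum x s t + x a := by
    rw [signedSum, Finset.insert_sdiff_insert, Finset.sdiff_insert_of_notMem ha,
      Finset.sum_insert hat, signedSum]
    abel
  rw [hminus, hplus, add_comm]

theorem sum_signedSum_of_parallelogram {F : V → ℝ}
    (hF : ∀ a b, F (a + b) + F (a - b) = 2 * (F a + F b)) (x : κ → V) (s : Finset κ) :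
    ∑ t ∈ s.powerset, F (signedSum x s t) = 2 ^ s.card * ∑ k ∈ s, F (x k) := by
  induction s using Finset.induction_on with
  | empty =>
    have hF0 : F 0 = 0 := by
      have h := hF 0 0
      rw [add_zero, sub_zero] at h
      linarith
    simp [signedSum, hF0]
  | insert a s ha ih =>
    simp only [sum_powerset_insert_signedSum F x ha, hF, ← Finset.mul_sum, Finset.sum_add_distrib,
      ih, Finset.sum_const, Finset.card_powerset, nsmul_eq_mul, Finset.card_insert_of_notMem ha,
      Finset.sum_insert ha]
    push_cast
    ring

theorem sum_map_signedSum [Module ℝ V] (Q : QuadraticForm ℝ V) (x : κ → V) (s : Finset κ) :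
    ∑ t ∈ s.powerset, Q (signedSum x s t) = 2 ^ s.card * ∑ k ∈ s, Q (x k) :=
  sum_signedSum_of_parallelogram (map_add_add_map_sub Q) x s

variable {E : Type*} [SeminormedAddCommGroup E] [InnerProductSpace ℝ E]

theorem norm_add_pow_four_add_norm_sub_pow_four_le (a b : E) :
    ‖a + b‖ ^ 4 + ‖a - b‖ ^ 4 ≤ 2 * (‖a‖ ^ 4 + 6 * ‖a‖ ^ 2 * ‖b‖ ^ 2 + ‖b‖ ^ 4) := by
  have hparallelogram := parallelogram_law_with_norm ℝ a b
  have hadd : ‖a + b‖ ^ 2 ≤ (‖a‖ + ‖b‖) ^ 2 := by gcongr; exact norm_add_le a b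
  have hsub : ‖a - b‖ ^ 2 ≤ (‖a‖ + ‖b‖) ^ 2 := by gcongr; exact norm_sub_le a b
  have hdev : (‖a + b‖ ^ 2 - (‖a‖ ^ 2 + ‖b‖ ^ 2)) ^ 2 ≤ (2 * ‖a‖ * ‖b‖) ^ 2 :=
    sq_le_sq' (by linarith) (by linarith)
  have hsub_eq : ‖a - b‖ ^ 2 = 2 * (‖a‖ ^ 2 + ‖b‖ ^ 2) - ‖a + b‖ ^ 2 := by linarith
  calc ‖a + b‖ ^ 4 + ‖a - b‖ ^ 4
      = 2 * (‖a‖ ^ 2 + ‖b‖ ^ 2) ^ 2 + 2 * (‖a + b‖ ^ 2 - (‖a‖ ^ 2 + ‖b‖ ^ 2)) ^ 2 := by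
        rw [show ‖a - b‖ ^ 4 = (‖a - b‖ ^ 2) ^ 2 by ring, hsub_eq]
        ring
    _ ≤ 2 * (‖a‖ ^ 2 + ‖b‖ ^ 2) ^ 2 + 2 * (2 * ‖a‖ * ‖b‖) ^ 2 := by gcongr
    _ = 2 * (‖a‖ ^ 4 + 6 * ‖a‖ ^ 2 * ‖b‖ ^ 2 + ‖b‖ ^ 4) := by ring

theorem sum_norm_signedSum_sq (x : κ → E) (s : Finset κ) :
    ∑ t ∈ s.powerset, ‖signedSum x s t‖ ^ 2 = 2 ^ s.card * ∑ k ∈ s, ‖x k‖ ^ 2 :=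
  sum_signedSum_of_parallelogram (F := fun a => ‖a‖ ^ 2) (parallelogram_law_with_norm ℝ)
    x s

theorem sum_norm_signedSum_pow_four_le (x : κ → E) (s : Finset κ) :
    ∑ t ∈ s.powerset, ‖signedSum x s t‖ ^ 4 ≤ 3 * 2 ^ s.card * (∑ k ∈ s, ‖x k‖ ^ 2) ^ 2 := by
  induction s using Finset.induction_on with
  | empty => simp [signedSum]
  | insert a s ha ih =>
    rw [sum_powerset_insert_signedSum (fun v => ‖v‖ ^ 4) x ha, Finset.card_insert_of_notMem ha,
      Finset.sum_insert ha]
    set S := ∑ k ∈ s, ‖x k‖ ^ 2 with hS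
    calc ∑ t ∈ s.powerset, (‖signedSum x s t + x a‖ ^ 4 + ‖signedSum x s t - x a‖ ^ 4)
        ≤ ∑ t ∈ s.powerset, 2 * (‖signedSum x s t‖ ^ 4 +
            6 * ‖signedSum x s t‖ ^ 2 * ‖x a‖ ^ 2 + ‖x a‖ ^ 4) :=
          Finset.sum_le_sum fun t _ => norm_add_pow_four_add_norm_sub_pow_four_le _ _
      _ = 2 * (∑ t ∈ s.powerset, ‖signedSum x s t‖ ^ 4 +
            6 * (2 ^ s.card * S) * ‖x a‖ ^ 2 + 2 ^ s.card * ‖x a‖ ^ 4) := by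
          simp only [← Finset.mul_sum, Finset.sum_add_distrib, ← Finset.sum_mul,
            sum_norm_signedSum_sq, Finset.sum_const, Finset.card_powerset, nsmul_eq_mul, hS]
          push_cast
          rfl
      _ ≤ 2 * (3 * 2 ^ s.card * S ^ 2 +
            6 * (2 ^ s.card * S) * ‖x a‖ ^ 2 + 3 * (2 ^ s.card * ‖x a‖ ^ 4)) := by
          have hpos : 0 ≤ 2 ^ s.card * ‖x a‖ ^ 4 := by positivity
          linarith
      _ = 3 * 2 ^ (s.card + 1) * (‖x a‖ ^ 2 + S) ^ 2 := by ring

end SignedSums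

section Truncation

variable {E : Type*} [SeminormedAddCommGroup E]

open Classical in
/-- Truncation at squared norm `R`: vectors with `‖v‖ ^ 2 > R` are replaced by zero. -/
noncomputable def truncate (R : ℝ) (v : E) : E :=
  if ‖v‖ ^ 2 ≤ R then v else 0

theorem norm_truncate_sq_le {R : ℝ} (hR : 0 ≤ R) (v : E) : ‖truncate R v‖ ^ 2 ≤ R := by
  by_cases h : ‖v‖ ^ 2 ≤ R <;> simp [truncate, h, hR]

theorem norm_truncate_le (R : ℝ) (v : E) : ‖truncate R v‖ ≤ ‖v‖ := by
  by_cases h : ‖v‖ ^ 2 ≤ R <;> simp [truncate, h]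

theorem norm_add_truncate_sq_le (R : ℝ) (v : E) : ‖v + truncate R v‖ ^ 2 ≤ 4 * ‖v‖ ^ 2 :=
  calc ‖v + truncate R v‖ ^ 2 ≤ (‖v‖ + ‖v‖) ^ 2 := by
        gcongr
        exact norm_add_le_of_le le_rfl (norm_truncate_le R v)
    _ = 4 * ‖v‖ ^ 2 := by ring

theorem mul_norm_sub_truncate_sq_le (R : ℝ) (v : E) :
    R * ‖v - truncate R v‖ ^ 2 ≤ ‖v‖ ^ 4 := by
  by_cases h : ‖v‖ ^ 2 ≤ R
  · rw [truncate, if_pos h, sub_self, norm_zero, zero_pow two_ne_zero, mul_zero]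
    positivity
  · rw [truncate, if_neg h, sub_zero]
    calc R * ‖v‖ ^ 2 ≤ ‖v‖ ^ 2 * ‖v‖ ^ 2 := by gcongr; exact (not_le.mp h).le
      _ = ‖v‖ ^ 4 := by ring

end Truncation

section Grothendieck

variable {ι : Type u} {E : Type v} [NormedAddCommGroup E] [NormedSpace ℝ E]

/-- `C` is a Grothendieck bound of `Q` if `|∑ k, Q (x k)| ≤ C * c` for all finite families `x`
whose coordinates satisfy `∑ k, ‖x k i‖ ^ 2 ≤ c`. The scale `c > 0` is part of the definition so
that averages over large probability spaces can be inserted without normalization. -/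
def IsGrothendieckBound (Q : QuadraticForm ℝ (ι → E)) (C : ℝ) : Prop :=
  ∀ (κ : Type w) [Fintype κ] (x : κ → ι → E) (c : ℝ), 0 < c → (∀ i, ∑ k, ‖x k i‖ ^ 2 ≤ c) →
    |∑ k, Q (x k)| ≤ C * c

variable {Q : QuadraticForm ℝ (ι → E)} {C θ : ℝ}

theorem isGrothendieckBound_card_mul [Fintype ι] [DecidableEq ι] [Nontrivial E]
    (hQ : ∀ i u, Q (Pi.single i u) = 0)
    (hθ : ∀ x, (∀ i, ‖x i‖ = 1) → |Q x| ≤ θ) :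
    IsGrothendieckBound.{u, v, w} Q (Fintype.card ι * θ) := by
  intro κ _ x c _ hx
  have hθ0 : 0 ≤ θ := by
    simpa using abs_map_add_le_of_norm_le_one (t := 0) (w := 0) hQ (by simpa using hθ) (by simp)
  have hQx : ∀ k, |Q (x k)| ≤ (∑ i, ‖x k i‖ ^ 2) * θ := fun k =>
    abs_map_le_mul_of_norm_sq_le hQ hθ (by positivity) fun i =>
      Finset.single_le_sum (f := fun i => ‖x k i‖ ^ 2) (fun _ _ => sq_nonneg _) (Finset.mem_univ i)
  calc |∑ k, Q (x k)| ≤ ∑ k, |Q (x k)| := Finset.abs_sum_le_sum_abs _ _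
    _ ≤ ∑ k, (∑ i, ‖x k i‖ ^ 2) * θ := Finset.sum_le_sum fun k _ => hQx k
    _ = (∑ i, ∑ k, ‖x k i‖ ^ 2) * θ := by rw [← Finset.sum_mul, Finset.sum_comm]
    _ ≤ (∑ _i : ι, c) * θ := by
      gcongr with i
      exact hx i
    _ = Fintype.card ι * θ * c := by
      rw [Finset.sum_const, Finset.card_univ, nsmul_eq_mul]
      ring

theorem IsGrothendieckBound.abs_sum_polar_le (hC : IsGrothendieckBound.{u, v, w} Q C)
    {κ : Type w} [Fintype κ] {x y : κ → ι → E} {c : ℝ} (hc : 0 < c)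
    (hx : ∀ i, ∑ k, ‖x k i‖ ^ 2 ≤ c) (hy : ∀ i, ∑ k, ‖y k i‖ ^ 2 ≤ c) :
    |∑ k, QuadraticMap.polar Q (x k) (y k)| ≤ 4 * C * c := by
  have hsum : ∀ z : κ → ι → E, (∀ k i, ‖z k i‖ ≤ ‖x k i‖ + ‖y k i‖) →
      |∑ k, Q (z k)| ≤ C * (4 * c) := fun z hz => by
    refine hC κ z _ (by positivity) fun i => ?_
    calc ∑ k, ‖z k i‖ ^ 2 ≤ ∑ k, (2 * ‖x k i‖ ^ 2 + 2 * ‖y k i‖ ^ 2) :=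
          Finset.sum_le_sum fun k _ => by
            nlinarith [hz k i, norm_nonneg (z k i), sq_nonneg (‖x k i‖ - ‖y k i‖)]
      _ = 2 * ∑ k, ‖x k i‖ ^ 2 + 2 * ∑ k, ‖y k i‖ ^ 2 := by
          rw [Finset.sum_add_distrib, Finset.mul_sum, Finset.mul_sum]
      _ ≤ 4 * c := by linarith [hx i, hy i]
  have hadd := abs_le.mp (hsum (fun k => x k + y k) fun k i => norm_add_le _ _)
  have hsub := abs_le.mp (hsum (fun k => x k - y k) fun k i => norm_sub_le _ _)
  have hpolar : 2 * ∑ k, QuadraticMap.polar Q (x k) (y k) =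
      ∑ k, Q (x k + y k) - ∑ k, Q (x k - y k) := by
    rw [Finset.mul_sum, ← Finset.sum_sub_distrib]
    exact Finset.sum_congr rfl fun k _ => (map_add_sub_map_sub Q _ _).symm
  rw [abs_le]
  constructor <;> linarith [hadd.1, hadd.2, hsub.1, hsub.2]

theorem IsGrothendieckBound.abs_sum_sub_map_truncate_le
    (hC : IsGrothendieckBound.{u, v, w} Q C) {κ : Type w} [Fintype κ] {f : κ → ι → E} {c R : ℝ}
    (hc : 0 < c) (hR : 0 < R) (h2 : ∀ i, ∑ k, ‖f k i‖ ^ 2 ≤ c)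
    (h4 : ∀ i, 64 * ∑ k, ‖f k i‖ ^ 4 ≤ R * c) :
    |∑ k, (Q (f k) - Q fun i => truncate R (f k i))| ≤ C / 2 * c := by
  let g : κ → ι → E := fun k i => truncate R (f k i)
  have hadd : ∀ i, ∑ k, ‖(f k + g k) i‖ ^ 2 ≤ 4 * c := fun i =>
    calc ∑ k, ‖(f k + g k) i‖ ^ 2 ≤ ∑ k, 4 * ‖f k i‖ ^ 2 :=
          Finset.sum_le_sum fun k _ => norm_add_truncate_sq_le R (f k i)
      _ ≤ 4 * c := by
          rw [← Finset.mul_sum]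
          linarith [h2 i]
  have hsub : ∀ i, ∑ k, ‖((16 : ℝ) • (f k - g k)) i‖ ^ 2 ≤ 4 * c := fun i => by
    refine le_of_mul_le_mul_left ?_ hR
    calc R * ∑ k, ‖((16 : ℝ) • (f k - g k)) i‖ ^ 2
        = 256 * ∑ k, R * ‖f k i - truncate R (f k i)‖ ^ 2 := by
          rw [Finset.mul_sum, Finset.mul_sum]
          refine Finset.sum_congr rfl fun k _ => ?_
          rw [Pi.smul_apply, norm_smul, Real.norm_of_nonneg (by norm_num), Pi.sub_apply]
          ring
      _ ≤ 256 * ∑ k, ‖f k i‖ ^ 4 := by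
          gcongr with k
          exact mul_norm_sub_truncate_sq_le R (f k i)
      _ ≤ R * (4 * c) := by linarith [h4 i]
  have hpolar := abs_le.mp (hC.abs_sum_polar_le (by positivity) hadd hsub)
  simp only [QuadraticMap.polar_smul_right, polar_add_sub, smul_eq_mul, ← Finset.mul_sum] at hpolar
  rw [abs_le]
  constructor <;> linarith [hpolar.1, hpolar.2]

end Grothendieck

section GrothendieckInequality

variable {ι : Type u} {E : Type v} [Finite ι] [DecidableEq ι] [NormedAddCommGroup E]
  [InnerProductSpace ℝ E] [Nontrivial E] {Q : QuadraticForm ℝ (ι → E)} {C θ : ℝ}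

theorem IsGrothendieckBound.add_half (hQ : ∀ i u, Q (Pi.single i u) = 0)
    (hθ : ∀ x, (∀ i, ‖x i‖ = 1) → |Q x| ≤ θ) (hC : IsGrothendieckBound.{u, v, w} Q C) :
    IsGrothendieckBound.{u, v, w} Q (192 * θ + C / 2) := by
  classical
  intro κ _ x c hc hx
  let f : Finset κ → ι → E := signedSum x Finset.univ
  let g : Finset κ → ι → E := fun t i => truncate (192 * c) (f t i)
  let N : ℝ := 2 ^ Fintype.card κ
  have hN : 0 < N := by positivity
  have hf : ∑ t, Q (f t) = N * ∑ k, Q (x k) := by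
    simpa using sum_map_signedSum Q x Finset.univ
  have hf2 : ∀ i, ∑ t, ‖f t i‖ ^ 2 ≤ N * c := fun i => by
    have h := sum_norm_signedSum_sq (fun k => x k i) Finset.univ
    simp only [← signedSum_apply, Finset.powerset_univ, Finset.card_univ] at h
    exact h.trans_le (mul_le_mul_of_nonneg_left (hx i) hN.le)
  have hf4 : ∀ i, 64 * ∑ t, ‖f t i‖ ^ 4 ≤ 192 * c * (N * c) := fun i => by
    have h := sum_norm_signedSum_pow_four_le (fun k => x k i) Finset.univ
    simp only [← signedSum_apply, Finset.powerset_univ, Finset.card_univ] at h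
    calc 64 * ∑ t, ‖f t i‖ ^ 4 ≤ 64 * (3 * N * (∑ k, ‖x k i‖ ^ 2) ^ 2) := by gcongr
      _ ≤ 64 * (3 * N * c ^ 2) := by gcongr; exact hx i
      _ = 192 * c * (N * c) := by ring
  have herror : |∑ t, (Q (f t) - Q (g t))| ≤ C / 2 * (N * c) :=
    hC.abs_sum_sub_map_truncate_le (by positivity) (by positivity) hf2 hf4
  have hg : |∑ t, Q (g t)| ≤ N * (192 * c * θ) :=
    calc |∑ t, Q (g t)| ≤ ∑ t, |Q (g t)| := Finset.abs_sum_le_sum_abs _ _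
      _ ≤ ∑ _t : Finset κ, 192 * c * θ := Finset.sum_le_sum fun t _ =>
          abs_map_le_mul_of_norm_sq_le hQ hθ (by positivity) fun i =>
            norm_truncate_sq_le (by positivity) (f t i)
      _ = N * (192 * c * θ) := by simp [N]
  refine le_of_mul_le_mul_left ?_ hN
  calc N * |∑ k, Q (x k)| = |∑ t, Q (g t) + ∑ t, (Q (f t) - Q (g t))| := by
        rw [Finset.sum_sub_distrib, add_sub_cancel, hf, abs_mul, abs_of_pos hN]
    _ ≤ N * (192 * c * θ) + C / 2 * (N * c) := (abs_add_le _ _).trans (add_le_add hg herror)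
    _ = N * ((192 * θ + C / 2) * c) := by ring

theorem abs_sum_map_le_of_map_single_eq_zero (hQ : ∀ i u, Q (Pi.single i u) = 0)
    (hθ : ∀ x, (∀ i, ‖x i‖ = 1) → |Q x| ≤ θ) {κ : Type w} [Fintype κ] {x : κ → ι → E}
    (hx : ∀ i, ∑ k, ‖x k i‖ ^ 2 ≤ 1) : |∑ k, Q (x k)| ≤ 384 * θ := by
  cases nonempty_fintype ι
  let S : Set ℝ := {C | IsGrothendieckBound.{u, v, w} Q C}
  have hne : S.Nonempty := ⟨_, isGrothendieckBound_card_mul hQ hθ⟩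
  have hlower : ∀ C ∈ S, |∑ k, Q (x k)| ≤ C := fun C hC => by
    simpa using hC κ x 1 one_pos hx
  have hhalf : 2 * (sInf S - 192 * θ) ≤ sInf S := le_csInf hne fun C hC => by
    have h : sInf S ≤ 192 * θ + C / 2 :=
      csInf_le ⟨_, hlower⟩ (IsGrothendieckBound.add_half hQ hθ hC)
    linarith
  linarith [le_csInf hne hlower]

end GrothendieckInequality

section MatrixForms

open Matrix

variable {𝕜 : Type*} [RCLike 𝕜] {ι : Type*} [Fintype ι]

/-- The real quadratic form `x ↦ Re (x* A x)` of a square matrix `A` over `𝕜`, which is `x* A x`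
itself when `A` is Hermitian. -/
noncomputable def reQuadForm (A : Matrix ι ι 𝕜) : QuadraticForm ℝ (ι → 𝕜) :=
  LinearMap.BilinMap.toQuadraticMap <| LinearMap.mk₂ ℝ (fun v w => RCLike.re (star v ⬝ᵥ A *ᵥ w))
    (fun u v w => by simp [add_dotProduct])
    (fun r v w => by simp [star_smul, smul_dotProduct, RCLike.smul_re])
    (fun u v w => by simp [mulVec_add, dotProduct_add])
    (fun r v w => by simp [mulVec_smul, dotProduct_smul, RCLike.smul_re])

theorem reQuadForm_apply (A : Matrix ι ι 𝕜) (x : ι → 𝕜) :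
    reQuadForm A x = RCLike.re (star x ⬝ᵥ A *ᵥ x) :=
  rfl

theorem reQuadForm_add (A B : Matrix ι ι 𝕜) (x : ι → 𝕜) :
    reQuadForm (A + B) x = reQuadForm A x + reQuadForm B x := by
  simp only [reQuadForm_apply, add_mulVec, dotProduct_add, map_add]

theorem ofReal_reQuadForm {A : Matrix ι ι 𝕜} (hA : A.IsHermitian) (x : ι → 𝕜) :
    (reQuadForm A x : 𝕜) = star x ⬝ᵥ A *ᵥ x :=
  RCLike.ext (by simp [reQuadForm_apply])
    (by rw [RCLike.ofReal_im, hA.im_star_dotProduct_mulVec_self])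

theorem reQuadForm_diagonal [DecidableEq ι] (D : ι → 𝕜) (x : ι → 𝕜) :
    reQuadForm (diagonal D) x = ∑ i, RCLike.re (D i) * ‖x i‖ ^ 2 := by
  rw [reQuadForm_apply, dotProduct, map_sum]
  refine Finset.sum_congr rfl fun i _ => ?_
  rw [mulVec_diagonal, Pi.star_apply, RCLike.star_def, mul_left_comm, RCLike.conj_mul, mul_comm,
    ← RCLike.ofReal_pow, RCLike.re_ofReal_mul, mul_comm]

theorem reQuadForm_single [DecidableEq ι] (A : Matrix ι ι 𝕜) (i : ι) (u : 𝕜) :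
    reQuadForm A (Pi.single i u) = RCLike.re (A i i) * ‖u‖ ^ 2 := by
  have hentry : star (Pi.single i u) ⬝ᵥ A *ᵥ Pi.single i u = A i i * (star u * u) := by
    simp [Pi.star_single, mul_left_comm, mul_comm]
  rw [reQuadForm_apply, hentry, RCLike.star_def, RCLike.conj_mul, ← RCLike.ofReal_pow,
    RCLike.re_mul_ofReal]

theorem reQuadForm_eq_sub_diagonal_add [DecidableEq ι] (A : Matrix ι ι 𝕜) (x : ι → 𝕜) :
    reQuadForm A x =
      reQuadForm (A - diagonal A.diag) x + ∑ i, RCLike.re (A i i) * ‖x i‖ ^ 2 := by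
  have hdiag : ∑ i, RCLike.re (A i i) * ‖x i‖ ^ 2 = reQuadForm (diagonal A.diag) x :=
    (reQuadForm_diagonal A.diag x).symm
  rw [hdiag, ← reQuadForm_add, sub_add_cancel]

theorem abs_sum_reQuadForm_le {A : Matrix ι ι 𝕜} {θ : ℝ}
    (hθ : ∀ x : ι → 𝕜, (∀ i, ‖x i‖ = 1) → |reQuadForm A x| ≤ θ)
    {κ : Type*} [Fintype κ] {x : κ → ι → 𝕜} (hx : ∀ i, ∑ k, ‖x k i‖ ^ 2 = 1) :
    |∑ k, reQuadForm A (x k)| ≤ 769 * θ := by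
  classical
  set B := A - diagonal A.diag with hB
  set t : ℝ := ∑ i, RCLike.re (A i i) with ht
  have hB0 : ∀ i u, reQuadForm B (Pi.single i u) = 0 := fun i u => by
    simp [reQuadForm_single, hB]
  have hBt : ∀ y : ι → 𝕜, (∀ i, ‖y i‖ = 1) → |reQuadForm B y + t| ≤ θ := fun y hy => by
    have h := hθ y hy
    rw [reQuadForm_eq_sub_diagonal_add] at h
    simpa [hy] using h
  have ht_le : |t| ≤ θ := by
    simpa using abs_map_add_le_of_norm_le_one hB0 hBt (w := 0) (by simp)
  have hBθ : ∀ y : ι → 𝕜, (∀ i, ‖y i‖ = 1) → |reQuadForm B y| ≤ 2 * θ := fun y hy =>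
    calc |reQuadForm B y| = |reQuadForm B y + t - t| := by rw [add_sub_cancel_right]
      _ ≤ |reQuadForm B y + t| + |t| := abs_sub _ _
      _ ≤ 2 * θ := by linarith [hBt y hy]
  have hsum : ∑ k, reQuadForm A (x k) = ∑ k, reQuadForm B (x k) + t := by
    simp only [reQuadForm_eq_sub_diagonal_add A, Finset.sum_add_distrib, ← hB]
    rw [Finset.sum_comm]
    simp only [← Finset.mul_sum, hx, mul_one, ht]
  calc |∑ k, reQuadForm A (x k)| ≤ |∑ k, reQuadForm B (x k)| + |t| := hsum ▸ abs_add_le _ _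
    _ ≤ 384 * (2 * θ) + θ := add_le_add
        (abs_sum_map_le_of_map_single_eq_zero hB0 hBθ fun i => (hx i).le) ht_le
    _ = 769 * θ := by ring

end MatrixForms

section Seminorms

open Matrix

variable {𝕜 : Type*} [RCLike 𝕜] {n : ℕ} {A : Matrix (Fin n) (Fin n) 𝕜}

theorem norm_sum_sum_mul_star_mul (hA : A.IsHermitian) (x : Fin n → 𝕜) :
    ‖∑ i, ∑ j, A i j * star (x i) * x j‖ = |reQuadForm A x| := by
  rw [← RCLike.norm_ofReal (K := 𝕜), ofReal_reQuadForm hA]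
  simp only [dotProduct, mulVec, Finset.mul_sum, Pi.star_apply, mul_left_comm (A _ _), mul_assoc]

theorem norm_sum_sum_mul_inner (hA : A.IsHermitian) {d : ℕ}
    (x : Fin n → EuclideanSpace 𝕜 (Fin d)) :
    ‖∑ i, ∑ j, A i j * inner 𝕜 (x i) (x j)‖ = |∑ k, reQuadForm A fun i => x i k| := by
  rw [← RCLike.norm_ofReal (K := 𝕜), RCLike.ofReal_sum]
  simp only [ofReal_reQuadForm hA, dotProduct, mulVec, Finset.mul_sum, PiLp.inner_apply]
  rw [Finset.sum_comm_cycle]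
  simp only [RCLike.inner_apply, Pi.star_apply, RCLike.star_def, mul_comm, mul_assoc]

theorem thetaSeminorm_le (hA : A.IsHermitian) {θ : ℝ}
    (hθ : ∀ x ∈ unimodular 𝕜 n, |reQuadForm A x| ≤ θ) : thetaSeminorm A ≤ θ := by
  obtain ⟨x, hx, hxA⟩ := (isGreatest_thetaValues A).1
  rw [← hxA]
  exact (norm_sum_sum_mul_star_mul hA x).trans_le (hθ x hx)

theorem abs_reQuadForm_le_thetaSeminorm (hA : A.IsHermitian) {x : Fin n → 𝕜}
    (hx : x ∈ unimodular 𝕜 n) : |reQuadForm A x| ≤ thetaSeminorm A :=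
  (isGreatest_thetaValues A).2 ⟨x, hx, norm_sum_sum_mul_star_mul hA x⟩

theorem gammaSeminorm_le_mul_thetaSeminorm {d : ℕ} (hnd : n ≤ d) (hA : A.IsHermitian) :
    gammaSeminorm d A ≤ 769 * thetaSeminorm A := by
  obtain ⟨x, hx, hxA⟩ := (isGreatest_gammaValues hnd A).1
  rw [← hxA]
  refine (norm_sum_sum_mul_inner hA x).trans_le
    (abs_sum_reQuadForm_le (fun y hy => abs_reQuadForm_le_thetaSeminorm hA hy) fun i => ?_)
  rw [← EuclideanSpace.norm_sq_eq, hx i, one_pow]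

theorem one_le_of_mem_grothendieckConstants {K : ℝ} (hK : K ∈ grothendieckConstants 𝕜) :
    1 ≤ K := by
  have hγ : 1 ≤ gammaSeminorm 1 (1 : Matrix (Fin 1) (Fin 1) 𝕜) := by
    obtain ⟨x, hx⟩ := unitTuples_nonempty 𝕜 (le_refl 1)
    refine (isGreatest_gammaValues le_rfl _).2 ⟨x, hx, ?_⟩
    simp [inner_self_eq_norm_sq_to_K, hx 0]
  have hθ : thetaSeminorm (1 : Matrix (Fin 1) (Fin 1) 𝕜) = 1 := by
    obtain ⟨x, hx, hxθ⟩ := (isGreatest_thetaValues (1 : Matrix (Fin 1) (Fin 1) 𝕜)).1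
    rw [← hxθ]
    simp [hx 0]
  simpa [hθ] using hγ.trans (hK 1 1 le_rfl 1 isHermitian_one)

variable (𝕜) in
theorem isClosed_grothendieckConstants : IsClosed (grothendieckConstants 𝕜) := by
  simp only [grothendieckConstants, Set.ofPred_forall]
  exact isClosed_iInter fun n => isClosed_iInter fun d => isClosed_iInter fun _ =>
    isClosed_iInter fun A => isClosed_iInter fun _ => isClosed_le (by fun_prop) (by fun_prop)

variable (𝕜) in
theorem isLeast_Kγ : IsLeast (grothendieckConstants 𝕜) (Kγ 𝕜) :=
  (isClosed_grothendieckConstants 𝕜).isLeast_csInf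
    ⟨769, fun _ _ hnd _ hA => gammaSeminorm_le_mul_thetaSeminorm hnd hA⟩
    ⟨1, fun _ => one_le_of_mem_grothendieckConstants⟩

end Seminorms

section StretchSpread

open Matrix

variable {𝕜 : Type*} [RCLike 𝕜] {n : ℕ}

theorem quadValues_subset_traceValues (A : Matrix (Fin n) (Fin n) 𝕜) :
    quadValues A ⊆ traceValues A := by
  rintro _ ⟨x, hx, rfl⟩
  refine ⟨vecMulVec x (star x), ⟨posSemidef_vecMulVec_self_star x, fun i => ?_⟩, ?_⟩
  · simp [vecMulVec_apply, RCLike.mul_conj, hx i]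
  · simp [mul_vecMulVec, trace_vecMulVec, dotProduct_comm]

theorem stretch_nonneg (A : Matrix (Fin n) (Fin n) 𝕜) : 0 ≤ stretch A :=
  sub_nonneg.mpr ((isGreatest_quadValues A).2 (isLeast_quadValues A).1)

theorem stretch_le_spread (A : Matrix (Fin n) (Fin n) 𝕜) : stretch A ≤ spread A :=
  sub_le_sub
    ((isGreatest_traceValues A).2 (quadValues_subset_traceValues A (isGreatest_quadValues A).1))
    ((isLeast_traceValues A).2 (quadValues_subset_traceValues A (isLeast_quadValues A).1))

theorem abs_re_trace_mul_le_gammaSeminorm (A : Matrix (Fin n) (Fin n) 𝕜)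
    {X : Matrix (Fin n) (Fin n) 𝕜} (hX : X ∈ correlation 𝕜 n) :
    |RCLike.re (A * X).trace| ≤ gammaSeminorm n A := by
  -- `tr (A X)` pairs `A i j` with `X j i`, hence the transpose.
  have hXt : Xᵀ ∈ correlation 𝕜 n := ⟨hX.1.transpose, hX.2⟩
  rw [correlation_eq_gram] at hXt
  obtain ⟨x, hx, hxX⟩ := hXt
  refine (RCLike.abs_re_le_norm _).trans ((isGreatest_gammaValues le_rfl A).2 ⟨x, hx, ?_⟩)
  have hinner : ∀ i j, inner 𝕜 (x i) (x j) = X j i := fun i j => congrFun₂ hxX i j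
  simp only [hinner, trace, diag_apply, mul_apply]

theorem spread_le_two_mul_gammaSeminorm (A : Matrix (Fin n) (Fin n) 𝕜) :
    spread A ≤ 2 * gammaSeminorm n A := by
  have habs : ∀ v ∈ traceValues A, |v| ≤ gammaSeminorm n A := by
    rintro _ ⟨X, hX, rfl⟩
    exact abs_re_trace_mul_le_gammaSeminorm A hX
  have hmax := (abs_le.mp (habs _ (isGreatest_traceValues A).1)).2
  have hmin := (abs_le.mp (habs _ (isLeast_traceValues A).1)).1
  rw [spread]
  linarith

theorem traceValues_add_smul_one (A : Matrix (Fin n) (Fin n) 𝕜) (s : ℝ) :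
    traceValues (A + (s : 𝕜) • 1) = (· + s * n) '' traceValues A := by
  rw [traceValues, traceValues, Set.image_image]
  refine Set.image_congr fun X hX => ?_
  have htrace : X.trace = n := by simp [trace, hX.2]
  simp [add_mul, htrace, RCLike.smul_re]

theorem spread_add_smul_one (A : Matrix (Fin n) (Fin n) 𝕜) (s : ℝ) :
    spread (A + (s : 𝕜) • 1) = spread A := by
  have hmono : Monotone (· + s * n) := fun _ _ h => add_le_add_left h _
  rw [spread, traceValues_add_smul_one, (hmono.map_isGreatest (isGreatest_traceValues A)).csSup_eq,
    (hmono.map_isLeast (isLeast_traceValues A)).csInf_eq, spread]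
  ring

theorem isHermitian_add_smul_one {ι : Type*} [DecidableEq ι] {A : Matrix ι ι 𝕜}
    (hA : A.IsHermitian) (s : ℝ) : (A + (s : 𝕜) • 1).IsHermitian :=
  hA.add (isHermitian_one.smul (by simp [isSelfAdjoint_iff]))

theorem reQuadForm_add_smul_one (A : Matrix (Fin n) (Fin n) 𝕜) (s : ℝ) {x : Fin n → 𝕜}
    (hx : x ∈ unimodular 𝕜 n) : reQuadForm (A + (s : 𝕜) • 1) x = reQuadForm A x + s * n := by
  rw [reQuadForm_add, smul_one_eq_diagonal, reQuadForm_diagonal]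
  simp [show ∀ i, ‖x i‖ = 1 from hx, mul_comm]

theorem exists_thetaSeminorm_add_smul_one_le {A : Matrix (Fin n) (Fin n) 𝕜} (hA : A.IsHermitian) :
    ∃ s : ℝ, thetaSeminorm (A + (s : 𝕜) • 1) ≤ stretch A / 2 := by
  rcases eq_or_ne n 0 with rfl | hn
  · refine ⟨0, thetaSeminorm_le (isHermitian_add_smul_one hA 0) fun x _ => ?_⟩
    rw [Subsingleton.elim x 0, QuadraticMap.map_zero, abs_zero]
    linarith [stretch_nonneg A]
  set M := sSup (quadValues A)
  set m := sInf (quadValues A)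
  have hn' : (n : ℝ) ≠ 0 := Nat.cast_ne_zero.mpr hn
  refine ⟨-((M + m) / 2) / n, thetaSeminorm_le (isHermitian_add_smul_one hA _) fun x hx => ?_⟩
  have hxA : reQuadForm A x ∈ quadValues A := ⟨x, hx, rfl⟩
  have hM : reQuadForm A x ≤ M := (isGreatest_quadValues A).2 hxA
  have hm : m ≤ reQuadForm A x := (isLeast_quadValues A).2 hxA
  have hstretch : stretch A = M - m := rfl
  rw [reQuadForm_add_smul_one A _ hx, div_mul_cancel₀ _ hn', hstretch, abs_le]
  constructor <;> linarith

theorem spread_le_mul_stretch {K : ℝ} (hK : K ∈ grothendieckConstants 𝕜)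
    {A : Matrix (Fin n) (Fin n) 𝕜} (hA : A.IsHermitian) : spread A ≤ K * stretch A := by
  obtain ⟨s, hs⟩ := exists_thetaSeminorm_add_smul_one_le hA
  have hK0 : 0 ≤ K := zero_le_one.trans (one_le_of_mem_grothendieckConstants hK)
  set B := A + (s : 𝕜) • 1
  calc spread A = spread B := (spread_add_smul_one A s).symm
    _ ≤ 2 * gammaSeminorm n B := spread_le_two_mul_gammaSeminorm B
    _ ≤ 2 * (K * thetaSeminorm B) := by
        gcongr
        exact hK n n le_rfl B (isHermitian_add_smul_one hA s)
    _ ≤ 2 * (K * (stretch A / 2)) := by gcongr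
    _ = K * stretch A := by ring

end StretchSpread

end SymGrothendieck

theorem mainTheorem6 (𝕜 : Type*) [RCLike 𝕜] :
    IsLeast (SymGrothendieck.grothendieckConstants 𝕜) (SymGrothendieck.Kγ 𝕜) ∧
    ∀ (n : ℕ) (A : Matrix (Fin n) (Fin n) 𝕜), A.IsHermitian →
      SymGrothendieck.stretch A ≤ SymGrothendieck.spread A ∧
      SymGrothendieck.spread A ≤ SymGrothendieck.Kγ 𝕜 * SymGrothendieck.stretch A := by
  have hKγ := SymGrothendieck.isLeast_Kγ 𝕜
  exact ⟨hKγ, fun _ A hA =>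
    ⟨SymGrothendieck.stretch_le_spread A, SymGrothendieck.spread_le_mul_stretch hKγ.1 hA⟩⟩
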